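/- For a natural number $d$ and $A \subseteq \mathbb{R}^d$ let $\dim_H(A)$ denote the Hausdorff dimension of $A$, and let $\dim_F(A)$ denote its Fourier dimension, that is, the supremum of all $s \in [0,d]$ for which there is a non-zero finite Borel measure $\mu$ on $\mathbb{R}^d$ with compact support contained in $A$ such that $\sup_{\xi \in \mathbb{R}^d} |\widehat{\mu}(\xi)|^2 |\xi|^s < \infty$, where $\widehat{\mu}(\xi) = \int_{\mathbb{R}^d} e^{-2\pi i x \cdot \xi}\, d\mu(x)$. Let $R \subseteq (0,\infty)$ and $Y, Z \subseteq \mathbb{R}^d$ be non-empty compact sets, and write $RY = \{ry : r \in R,\ y \in Y\}$ and $RY+Z = \{ry+z : r \in R,\ y \in Y,\ z \in Z\}$. If $$\max\{\dim_F(RY)+\dim_H(Z),\ \dim_H(RY)+\dim_F(Z)\} > d,$$ then $RY+Z$ has positive Lebesgue measure. -/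

import Mathlib

open MeasureTheory
open scoped NNReal ENNReal Pointwise

/-- The Fourier transform `ξ ↦ ∫ exp (-2πi x·ξ) dμ(x)` of a (finite Borel) measure `μ` on `ℝ^d`. -/
noncomputable def measureFourier {d : ℕ} (μ : Measure (EuclideanSpace ℝ (Fin d)))
    (ξ : EuclideanSpace ℝ (Fin d)) : ℂ :=
  ∫ x, Complex.exp (-(2 * (Real.pi : ℂ) * Complex.I * ((inner ℝ x ξ : ℝ) : ℂ))) ∂μ

/-- `μ` is a non-zero finite Borel measure on `ℝ^d` whose support is compact and contained
in `A`. -/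
structure IsCompactlySupportedOn {d : ℕ} (μ : Measure (EuclideanSpace ℝ (Fin d)))
    (A : Set (EuclideanSpace ℝ (Fin d))) : Prop where
  finite : IsFiniteMeasure μ
  ne_zero : μ ≠ 0
  isCompact_support : IsCompact μ.support
  support_subset : μ.support ⊆ A

/-- The Fourier dimension of `A ⊆ ℝ^d`: the supremum of all `s ∈ [0, d]` such that
`sup_ξ |μ̂(ξ)|² |ξ|^s < ∞` for some non-zero finite Borel measure `μ` with compact support
contained in `A`. It takes values in `[0, d] ⊆ [0, ∞]`. -/
noncomputable def fourierDim {d : ℕ} (A : Set (EuclideanSpace ℝ (Fin d))) : ℝ≥0∞ :=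
  sSup {t : ℝ≥0∞ | ∃ s : ℝ≥0, t = s ∧ s ≤ (d : ℝ≥0) ∧
    ∃ μ : Measure (EuclideanSpace ℝ (Fin d)), IsCompactlySupportedOn μ A ∧
      ∃ C : ℝ, ∀ ξ, ‖measureFourier μ ξ‖ ^ 2 * ‖ξ‖ ^ (s : ℝ) ≤ C}

/-!
Write `A`, `B` for `R • Y`, `Z` in either order, and suppose that `A` carries a finite measure `μ`
with `|μ̂(ξ)|² ≤ C |ξ|^(-s)`, that `t < dimH B` and that `s + t > d`. If the compact set `A + B` were
null, it would have open neighbourhoods `U` of arbitrarily small measure. The function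
`g b = μ (U - b)` is constant, equal to the mass of `μ`, near `B`. On the other hand
`|ĝ(ξ)| = |μ̂(ξ)| |1̂_U(ξ)|`, so by the decay of `μ̂` and Plancherel's theorem, `g` is a Bessel
potential of order `s / 2` of a function `h` with `‖h‖₂² ≤ C' |U|`. (In the text `g` is mollified by
a heat kernel, which makes all Fourier integrals absolutely convergent.)

If the measure `ρ = |h|² dx` satisfied `ρ (B(b, r)) ≤ κ r^t` for all `r > 0`, then writing the Bessel
kernel as a superposition of heat kernels and applying the Cauchy-Schwarz inequality to each of them
would give `|g b| ≤ K √κ`, with `K` depending only on `d`, `s`, `t`; this is where `s + t > d` enters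
(`exists_norm_integral_bessel_le`). For a fixed small `κ` this is impossible, so each `b ∈ B` has a
ball with `ρ (B(b, r)) > κ r^t`, although the total mass of `ρ` is as small as desired. By Vitali's
covering theorem `B` is then null for the `t`-dimensional Hausdorff measure
(`hausdorffMeasure_eq_zero_of_exists_measure`), contradicting `t < dimH B`. In this way Frostman
measures on `B` are not needed.
-/

/-! ### Plancherel's theorem for integrable square-integrable functions -/

section Plancherel

open FourierTransform

variable {V : Type*} [NormedAddCommGroup V] [InnerProductSpace ℝ V] [FiniteDimensional ℝ V]
  [MeasurableSpace V] [BorelSpace V]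

theorem continuous_fourier_of_integrable {f : V → ℂ} (hf : Integrable f) : Continuous (𝓕 f) :=
  VectorFourier.fourierIntegral_continuous Real.continuous_fourierChar
    (L := innerₗ V) continuous_inner hf

theorem integral_fourier_mul_eq_of_integrable {f g : V → ℂ} (hf : Integrable f)
    (hg : Integrable g) : ∫ ξ, 𝓕 f ξ * g ξ = ∫ x, f x * 𝓕 g x := by
  simpa using! (VectorFourier.integral_fourierIntegral_smul_eq_flip (L := innerₗ V)
      Real.continuous_fourierChar continuous_inner hf hg)

/-- For an integrable square-integrable function, the Fourier transform on `L²` is almost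
everywhere given by the Fourier integral: both define the same tempered distribution. -/
theorem coeFn_fourier_toLp {f : V → ℂ} (hf : Integrable f) (hf2 : MemLp f 2) :
    ((𝓕 (hf2.toLp f) : Lp ℂ 2 (volume : Measure V)) : V → ℂ) =ᵐ[volume] 𝓕 f := by
  refine ae_eq_of_integral_contDiff_smul_eq
    ((Lp.memLp _).locallyIntegrable (by norm_num))
    (continuous_fourier_of_integrable hf).locallyIntegrable fun g hg hgc => ?_
  have hG : ContDiff ℝ (⊤ : ℕ∞) (fun x => (g x : ℂ)) := Complex.ofRealCLM.contDiff.comp hg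
  have hGc : HasCompactSupport (fun x => (g x : ℂ)) := hgc.comp_left (g := Complex.ofReal) rfl
  set G : SchwartzMap V ℂ := hGc.toSchwartzMap hG with hGdef
  have hGx : ∀ x, G x = g x := fun x => rfl
  have h1 := congrArg (fun T : TemperedDistribution V ℂ => T G)
    (Lp.fourier_toTemperedDistribution_eq (hf2.toLp f))
  simp only [TemperedDistribution.fourier_apply, Lp.toTemperedDistribution_apply] at h1
  have h2 : ∫ x, (𝓕 G : SchwartzMap V ℂ) x • (hf2.toLp f : V → ℂ) x = ∫ x, 𝓕 G x * f x := by
    refine integral_congr_ae ?_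
    filter_upwards [hf2.coeFn_toLp] with x hx
    rw [hx, smul_eq_mul]
  have h3 := integral_fourier_mul_eq_of_integrable (V := V) (f := fun x => G x) (g := f)
    G.integrable hf
  have h4 := (h1.symm.trans h2).trans h3
  simpa [hGx, Complex.real_smul] using h4

theorem lintegral_fourier_sq {f : V → ℂ} (hf : Integrable f) (hf2 : MemLp f 2) :
    ∫⁻ ξ, ‖𝓕 f ξ‖ₑ ^ 2 = ∫⁻ x, ‖f x‖ₑ ^ 2 := by
  have h : eLpNorm (𝓕 f) 2 volume = eLpNorm f 2 volume := by
    rw [← eLpNorm_congr_ae (coeFn_fourier_toLp hf hf2), ← Lp.enorm_def,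
      ← eLpNorm_congr_ae hf2.coeFn_toLp, ← Lp.enorm_def, ← ofReal_norm, ← ofReal_norm,
      Lp.norm_fourier_eq]
  have h2 := congrArg (fun t : ℝ≥0∞ => t ^ 2) h
  have key : ∀ g : V → ℂ, eLpNorm g 2 volume ^ 2 = ∫⁻ x, ‖g x‖ₑ ^ 2 := fun g => by
    have := eLpNorm_nnreal_pow_eq_lintegral (f := g) (μ := (volume : Measure V)) (p := 2)
      (by norm_num)
    simpa using this
  simpa only [key] using h2

theorem lintegral_fourierInv_sq {f : V → ℂ} (hf : Integrable f) (hf2 : MemLp f 2) :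
    ∫⁻ ξ, ‖𝓕⁻ f ξ‖ₑ ^ 2 = ∫⁻ x, ‖f x‖ₑ ^ 2 := by
  rw [← lintegral_fourier_sq hf hf2]
  simp only [Real.fourierInv_eq_fourier_neg]
  exact lintegral_neg_eq_self (fun ξ => ‖𝓕 f ξ‖ₑ ^ 2)

end Plancherel

/-! ### The heat kernel -/

section HeatKernel

open FourierTransform

variable {V : Type*} [NormedAddCommGroup V] [InnerProductSpace ℝ V]

/-- The Gaussian density `u^(-n/2) exp (-π |x|² / u)`, of total mass one, on an `n`-dimensional
space. Its Fourier transform is `exp (-π u |ξ|²)`. -/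
noncomputable def heatKernel (u : ℝ) (x : V) : ℝ :=
  u ^ (-(Module.finrank ℝ V / 2 : ℝ)) * Real.exp (-(Real.pi / u) * ‖x‖ ^ 2)

/-- The modulated Gaussian `exp (-π u |ξ|² + 2πi ⟨c, ξ⟩)`, whose Fourier transform is the heat
kernel at time `u` centred at `c`. -/
noncomputable def modGauss (u : ℝ) (c ξ : V) : ℂ :=
  Complex.exp (-((Real.pi * u : ℝ) : ℂ) * ‖ξ‖ ^ 2 + 2 * Real.pi * Complex.I * inner ℝ c ξ)

theorem heatKernel_nonneg {u : ℝ} (hu : 0 < u) (x : V) : 0 ≤ heatKernel u x := by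
  unfold heatKernel; positivity

theorem continuous_heatKernel (u : ℝ) : Continuous (heatKernel u : V → ℝ) := by
  unfold heatKernel; fun_prop

theorem norm_modGauss (u : ℝ) (c ξ : V) :
    ‖modGauss u c ξ‖ = Real.exp (-(Real.pi * u) * ‖ξ‖ ^ 2) := by
  rw [modGauss, Complex.norm_exp]
  congr 1
  have : (2 * Real.pi * Complex.I * (inner ℝ c ξ : ℝ) : ℂ) =
      ((2 * Real.pi * inner ℝ c ξ : ℝ) : ℂ) * Complex.I := by
    push_cast; ring
  rw [this, ← Complex.ofReal_pow, ← Complex.ofReal_neg, ← Complex.ofReal_mul, Complex.add_re,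
    Complex.ofReal_re, Complex.re_ofReal_mul, Complex.I_re, mul_zero, add_zero]

theorem modGauss_eq (u : ℝ) (c ξ : V) : modGauss u c ξ =
    Real.exp (-(Real.pi * u) * ‖ξ‖ ^ 2) * Complex.exp (2 * Real.pi * Complex.I * inner ℝ c ξ) := by
  rw [modGauss, Complex.exp_add]
  push_cast
  rfl

theorem continuous_modGauss (u : ℝ) (c : V) : Continuous (modGauss u c) := by
  unfold modGauss; fun_prop

variable [FiniteDimensional ℝ V] [MeasurableSpace V] [BorelSpace V]

theorem integrable_heatKernel {u : ℝ} (hu : 0 < u) : Integrable (heatKernel u : V → ℝ) := by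
  refine Integrable.const_mul ?_ _
  have := GaussianFourier.integrable_cexp_neg_mul_sq_norm_add (V := V)
    (b := ((Real.pi / u : ℝ) : ℂ))
    (by rw [Complex.ofReal_re]; positivity) 0 0
  convert! this.re using 2 with x
  simp only [zero_mul, add_zero, RCLike.re_to_complex]
  rw [← Complex.exp_ofReal_re]
  push_cast
  rfl

theorem integral_heatKernel {u : ℝ} (hu : 0 < u) : ∫ x : V, heatKernel u x = 1 := by
  unfold heatKernel
  rw [integral_const_mul, GaussianFourier.integral_rexp_neg_mul_sq_norm (by positivity),
    div_div_cancel₀ Real.pi_ne_zero, ← Real.rpow_add hu]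
  simp

theorem lintegral_heatKernel_sub {u : ℝ} (hu : 0 < u) (b : V) :
    ∫⁻ y : V, ENNReal.ofReal (heatKernel u (b - y)) = 1 := by
  rw [← ofReal_integral_eq_lintegral_ofReal ((integrable_heatKernel hu).comp_sub_left b)
    (Filter.Eventually.of_forall fun y => heatKernel_nonneg hu _),
    integral_sub_left_eq_self (fun y => heatKernel u y), integral_heatKernel hu, ENNReal.ofReal_one]

theorem integrable_modGauss {u : ℝ} (hu : 0 < u) (c : V) : Integrable (modGauss u c) :=
  GaussianFourier.integrable_cexp_neg_mul_sq_norm_add (by rw [Complex.ofReal_re]; positivity) _ _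

theorem fourier_modGauss {u : ℝ} (hu : 0 < u) (c w : V) :
    𝓕 (modGauss u c) w = heatKernel u (c - w) := by
  have := fourier_gaussian_innerProductSpace' (V := V) (b := ((Real.pi * u : ℝ) : ℂ))
    (by rw [Complex.ofReal_re]; positivity) c w
  refine this.trans ?_
  have e1 : (Real.pi / ((Real.pi * u : ℝ) : ℂ)) = ((u⁻¹ : ℝ) : ℂ) := by
    push_cast; field_simp [Real.pi_ne_zero]
  rw [heatKernel, e1]
  push_cast [Complex.ofReal_cpow hu.le]
  congr 1
  · rw [Complex.cpow_neg, Complex.inv_cpow]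
    rw [Complex.arg_ofReal_of_nonneg hu.le]; exact Real.pi_ne_zero.symm
  · congr 1
    have := hu.ne'
    have h : (u : ℂ) ≠ 0 := by exact_mod_cast this
    field_simp [Real.pi_ne_zero]

theorem integral_modGauss_mul_fourier {u : ℝ} (hu : 0 < u) (c : V) {f : V → ℂ}
    (hf : Integrable f) :
    ∫ ξ, modGauss u c ξ * 𝓕 f ξ = ∫ x, (heatKernel u (c - x) : ℂ) * f x := by
  rw [← integral_fourier_mul_eq_of_integrable (integrable_modGauss hu c) hf]
  simp only [fourier_modGauss hu]

/-- Damping `m` by a Gaussian averages `𝓕⁻ m` against the heat kernel. -/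
theorem integral_modGauss_mul {u : ℝ} (hu : 0 < u) (c : V) {m : V → ℂ} (hm : Integrable m) :
    ∫ ξ, modGauss u c ξ * m ξ = ∫ y, (heatKernel u (c - y) : ℂ) * 𝓕⁻ m y := by
  have hF : Integrable (𝓕 (modGauss u c)) := by
    simp only [funext (fourier_modGauss hu c)]
    exact ((integrable_heatKernel hu).comp_sub_left c).ofReal
  have hinv : 𝓕⁻ (𝓕 (modGauss u c)) = modGauss u c :=
    (continuous_modGauss u c).fourierInv_fourier_eq (integrable_modGauss hu c) hF
  -- the reflection `y ↦ -y` turns `𝓕⁻` into `𝓕` on both sides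
  have h1 := integral_fourier_mul_eq_of_integrable hF.comp_neg hm
  have h2 : 𝓕 (fun y => 𝓕 (modGauss u c) (-y)) = modGauss u c := by
    ext w
    rw [← congrFun hinv w, Real.fourierInv_eq_fourier_neg, Real.fourier_eq, Real.fourier_eq,
      ← integral_neg_eq_self]
    simp
  rw [h2] at h1
  rw [h1, ← integral_neg_eq_self]
  simp only [neg_neg, Real.fourierInv_eq_fourier_neg, fourier_modGauss hu]

end HeatKernel

/-! ### Gaussian averages of measures of polynomial growth -/

section BallGrowth

variable {V : Type*} [NormedAddCommGroup V]

/-- The sum `∑ exp (-π k²) (k + 1)^t`, a discrete version of the `t`-th Gaussian moment. -/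
noncomputable def gaussMoment (t : ℝ) : ℝ :=
  ∑' k : ℕ, Real.exp (-Real.pi * (k : ℝ) ^ 2) * ((k : ℝ) + 1) ^ t

theorem summable_gaussMoment (t : ℝ) :
    Summable fun k : ℕ => Real.exp (-Real.pi * (k : ℝ) ^ 2) * ((k : ℝ) + 1) ^ t := by
  obtain ⟨N, hN⟩ := exists_nat_ge t
  have h0 : Summable fun k : ℕ =>
      Real.exp 1 * (((k + 1 : ℕ) : ℝ) ^ N * Real.exp (-1 * ((k + 1 : ℕ) : ℝ))) :=
    ((summable_nat_add_iff 1).2 (Real.summable_pow_mul_exp_neg_nat_mul N one_pos)).mul_left _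
  refine h0.of_nonneg_of_le (fun k => by positivity) fun k => ?_
  have h1 : Real.exp (-Real.pi * (k : ℝ) ^ 2) ≤ Real.exp 1 * Real.exp (-1 * ((k + 1 : ℕ) : ℝ)) := by
    rw [← Real.exp_add, Real.exp_le_exp]
    push_cast
    have hk : (k : ℝ) ≤ (k : ℝ) ^ 2 := by exact_mod_cast Nat.le_self_pow two_ne_zero k
    nlinarith [Real.pi_gt_three, sq_nonneg (k : ℝ)]
  have h2 : ((k : ℝ) + 1) ^ t ≤ ((k + 1 : ℕ) : ℝ) ^ N := by
    push_cast
    rw [← Real.rpow_natCast]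
    exact Real.rpow_le_rpow_of_exponent_le (by linarith [(Nat.cast_nonneg k : (0:ℝ) ≤ k)]) hN
  calc _ ≤ (Real.exp 1 * Real.exp (-1 * ((k + 1 : ℕ) : ℝ))) * ((k + 1 : ℕ) : ℝ) ^ N := by gcongr
    _ = _ := by ring

theorem gaussMoment_nonneg (t : ℝ) : 0 ≤ gaussMoment t :=
  tsum_nonneg fun _ => by positivity

/-- A Gaussian is dominated by a superposition of indicator functions of concentric balls. -/
theorem ofReal_exp_neg_sq_le_tsum {u : ℝ} (hu : 0 < u) (b y : V) :
    ENNReal.ofReal (Real.exp (-(Real.pi / u) * ‖b - y‖ ^ 2)) ≤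
      ∑' k : ℕ, (Metric.closedBall b (((k : ℝ) + 1) * √u)).indicator
        (fun _ => ENNReal.ofReal (Real.exp (-Real.pi * (k : ℝ) ^ 2))) y := by
  have hsu : 0 < √u := Real.sqrt_pos.2 hu
  set q := ‖b - y‖ / √u with hq
  have hq0 : 0 ≤ q := by positivity
  refine le_trans ?_ (ENNReal.le_tsum ⌊q⌋₊)
  rw [Set.indicator_of_mem]
  · refine ENNReal.ofReal_le_ofReal (Real.exp_le_exp.2 ?_)
    have h1 : (⌊q⌋₊ : ℝ) ^ 2 ≤ q ^ 2 := by
      gcongr; exact Nat.floor_le hq0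
    have h2 : -(Real.pi / u) * ‖b - y‖ ^ 2 = -Real.pi * q ^ 2 := by
      rw [hq, div_pow, Real.sq_sqrt hu.le]; ring
    rw [h2]
    nlinarith [Real.pi_pos]
  · rw [Metric.mem_closedBall, dist_comm, dist_eq_norm, ← div_le_iff₀ hsu]
    exact (Nat.lt_floor_add_one q).le

variable [InnerProductSpace ℝ V] [MeasurableSpace V] [BorelSpace V]

theorem lintegral_heatKernel_le_of_ball_growth {ρ : Measure V} {b : V} {κ t u : ℝ}
    (hκ : 0 ≤ κ) (hu : 0 < u)
    (hρ : ∀ r : ℝ, 0 < r → ρ (Metric.closedBall b r) ≤ ENNReal.ofReal (κ * r ^ t)) :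
    ∫⁻ y, ENNReal.ofReal (heatKernel u (b - y)) ∂ρ ≤
      ENNReal.ofReal (κ * gaussMoment t * u ^ ((t - Module.finrank ℝ V) / 2)) := by
  have hsu : 0 < √u := Real.sqrt_pos.2 hu
  have hun : 0 ≤ u ^ (-(Module.finrank ℝ V / 2 : ℝ)) := by positivity
  have hsum : ∫⁻ y, ENNReal.ofReal (Real.exp (-(Real.pi / u) * ‖b - y‖ ^ 2)) ∂ρ ≤
      ENNReal.ofReal (κ * gaussMoment t * u ^ (t / 2)) := by
    calc _ ≤ ∫⁻ y, ∑' k : ℕ, (Metric.closedBall b (((k : ℝ) + 1) * √u)).indicator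
          (fun _ => ENNReal.ofReal (Real.exp (-Real.pi * (k : ℝ) ^ 2))) y ∂ρ :=
          lintegral_mono fun y => ofReal_exp_neg_sq_le_tsum hu b y
      _ = ∑' k : ℕ, ENNReal.ofReal (Real.exp (-Real.pi * (k : ℝ) ^ 2)) *
          ρ (Metric.closedBall b (((k : ℝ) + 1) * √u)) := by
          rw [lintegral_tsum fun k =>
            (measurable_const.indicator Metric.isClosed_closedBall.measurableSet).aemeasurable]
          simp only [lintegral_indicator_const Metric.isClosed_closedBall.measurableSet]
      _ ≤ ∑' k : ℕ, ENNReal.ofReal ((κ * u ^ (t / 2)) *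
          (Real.exp (-Real.pi * (k : ℝ) ^ 2) * ((k : ℝ) + 1) ^ t)) := by
          refine ENNReal.tsum_le_tsum fun k => ?_
          have hk : (0 : ℝ) < (k : ℝ) + 1 := by positivity
          refine (mul_le_mul_right (hρ _ (mul_pos hk hsu)) _).trans ?_
          rw [← ENNReal.ofReal_mul (Real.exp_nonneg _), Real.mul_rpow hk.le hsu.le,
            Real.sqrt_eq_rpow, ← Real.rpow_mul hu.le]
          refine ENNReal.ofReal_le_ofReal (le_of_eq ?_)
          rw [show 1 / 2 * t = t / 2 by ring]
          ring
      _ = _ := by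
          rw [← ENNReal.ofReal_tsum_of_nonneg (fun k => by positivity)
            ((summable_gaussMoment t).mul_left _), tsum_mul_left]
          congr 1
          rw [gaussMoment]
          ring
  simp only [heatKernel, ENNReal.ofReal_mul hun]
  rw [lintegral_const_mul' _ _ ENNReal.ofReal_ne_top]
  refine (mul_le_mul_right hsum _).trans ?_
  rw [← ENNReal.ofReal_mul hun]
  refine ENNReal.ofReal_le_ofReal (le_of_eq ?_)
  rw [show (t - Module.finrank ℝ V) / 2 = -(Module.finrank ℝ V / 2 : ℝ) + t / 2 by ring,
    Real.rpow_add hu]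
  ring

end BallGrowth

/-! ### Bessel potentials of square-integrable functions -/

section Bessel

open FourierTransform

variable {V : Type*} [NormedAddCommGroup V]

/-- The Bessel multiplier `(1 + |ξ|²)^(-a)` as a superposition of Gaussians. -/
theorem one_add_sq_rpow_neg_eq_integral {a : ℝ} (ha : 0 < a) (ξ : V) :
    (1 + ‖ξ‖ ^ 2) ^ (-a) = Real.pi ^ a / Real.Gamma a *
      ∫ u in Set.Ioi (0 : ℝ), u ^ (a - 1) * Real.exp (-(Real.pi * (1 + ‖ξ‖ ^ 2) * u)) := by
  have h1 : 0 < 1 + ‖ξ‖ ^ 2 := by positivity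
  have hG := (Real.Gamma_pos_of_pos ha).ne'
  rw [Real.integral_rpow_mul_exp_neg_mul_Ioi ha (by positivity), one_div,
    Real.inv_rpow (by positivity),
    Real.mul_rpow Real.pi_pos.le h1.le, Real.rpow_neg h1.le]
  have := (Real.rpow_pos_of_pos Real.pi_pos a).ne'
  have := (Real.rpow_pos_of_pos h1 a).ne'
  field_simp

theorem integrableOn_rpow_mul_exp_neg_pi {a : ℝ} (ha : 0 < a) :
    IntegrableOn (fun u : ℝ => u ^ (a - 1) * Real.exp (-(Real.pi * u))) (Set.Ioi 0) := by
  have := integrableOn_rpow_mul_exp_neg_mul_rpow (p := 1) (s := a - 1) (b := Real.pi)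
    (by linarith) one_pos Real.pi_pos
  simpa using this

variable [InnerProductSpace ℝ V] [FiniteDimensional ℝ V] [MeasurableSpace V] [BorelSpace V]

/-- By the Cauchy-Schwarz inequality for the heat kernel, a Gaussian average of the function
`𝓕⁻ m` is controlled by the growth at `b` of the measure with density `|𝓕⁻ m|²`. -/
theorem norm_integral_modGauss_mul_le {m : V → ℂ} (hm : Integrable m) {b : V} {κ t u : ℝ}
    (hκ : 0 ≤ κ) (hu : 0 < u)
    (hρ : ∀ r : ℝ, 0 < r → (volume.withDensity fun y => ‖𝓕⁻ m y‖ₑ ^ 2) (Metric.closedBall b r) ≤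
      ENNReal.ofReal (κ * r ^ t)) :
    ‖∫ ξ, modGauss u b ξ * m ξ‖ ≤
      √(κ * gaussMoment t) * u ^ ((t - Module.finrank ℝ V) / 4) := by
  have hcont : Continuous (𝓕⁻ m) := by
    have : 𝓕⁻ m = fun w => 𝓕 m (-w) := funext fun w => Real.fourierInv_eq_fourier_neg m w
    rw [this]
    exact (continuous_fourier_of_integrable hm).comp continuous_neg
  have hp : Measurable fun y : V => ENNReal.ofReal (heatKernel u (b - y)) :=
    (((continuous_heatKernel u).comp (continuous_const.sub continuous_id)).measurable).ennreal_ofReal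
  have hh : Measurable fun y => ‖𝓕⁻ m y‖ₑ := hcont.measurable.enorm
  have hW : ∫⁻ y, ENNReal.ofReal (heatKernel u (b - y)) * ‖𝓕⁻ m y‖ₑ ^ 2 ≤
      ENNReal.ofReal (κ * gaussMoment t * u ^ ((t - Module.finrank ℝ V) / 2)) := by
    refine le_trans (le_of_eq ?_) (lintegral_heatKernel_le_of_ball_growth hκ hu hρ)
    rw [lintegral_withDensity_eq_lintegral_mul _ (hh.pow_const 2) hp]
    exact lintegral_congr fun y => mul_comm _ _
  have hCS : ∫⁻ y, ENNReal.ofReal (heatKernel u (b - y)) * ‖𝓕⁻ m y‖ₑ ≤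
      ENNReal.ofReal (κ * gaussMoment t * u ^ ((t - Module.finrank ℝ V) / 2)) ^ (1 / 2 : ℝ) := by
    have := ENNReal.lintegral_mul_le_Lp_mul_Lq (volume : Measure V) Real.HolderConjugate.two_two
      (f := fun y => ENNReal.ofReal (heatKernel u (b - y)) ^ (1 / 2 : ℝ))
      (g := fun y => ENNReal.ofReal (heatKernel u (b - y)) ^ (1 / 2 : ℝ) * ‖𝓕⁻ m y‖ₑ)
      (hp.pow_const _).aemeasurable ((hp.pow_const _).mul hh).aemeasurable
    have e1 : ∀ x : ℝ≥0∞, x ^ (1 / 2 : ℝ) * x ^ (1 / 2 : ℝ) = x := fun x => by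
      rw [← ENNReal.rpow_add_of_nonneg _ _ (by norm_num) (by norm_num)]; norm_num
    have e2 : ∀ x : ℝ≥0∞, (x ^ (1 / 2 : ℝ)) ^ (2 : ℝ) = x := fun x => by
      rw [← ENNReal.rpow_mul]; norm_num
    simp only [Pi.mul_apply, ← mul_assoc, e1, e2, ENNReal.mul_rpow_of_nonneg _ _ zero_le_two,
      lintegral_heatKernel_sub hu, ENNReal.one_rpow, one_mul, ENNReal.rpow_two] at this
    exact this.trans (ENNReal.rpow_le_rpow hW (by norm_num))
  have hG := gaussMoment_nonneg t
  have hE : ‖∫ ξ, modGauss u b ξ * m ξ‖ₑ ≤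
      ENNReal.ofReal (κ * gaussMoment t * u ^ ((t - Module.finrank ℝ V) / 2)) ^ (1 / 2 : ℝ) := by
    rw [integral_modGauss_mul hu b hm]
    refine (enorm_integral_le_lintegral_enorm _).trans (le_trans (le_of_eq ?_) hCS)
    refine lintegral_congr fun y => ?_
    rw [enorm_mul, ← ofReal_norm, Complex.norm_real, Real.norm_of_nonneg (heatKernel_nonneg hu _)]
  rw [ENNReal.ofReal_rpow_of_nonneg (by positivity) (by norm_num), ← ofReal_norm,
    ENNReal.ofReal_le_ofReal_iff (by positivity), Real.mul_rpow (by positivity) (by positivity),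
    ← Real.sqrt_eq_rpow, ← Real.rpow_mul hu.le] at hE
  convert hE using 3
  ring

/-- If the measure with density `|𝓕⁻ m|²` has growth of order `t` at `b`, where `s + t > n`, then
the Bessel potential of order `s / 2` of `𝓕⁻ m` is controlled at `b`. -/
theorem exists_norm_integral_bessel_le {s t : ℝ} (hs : 0 < s)
    (hst : (Module.finrank ℝ V : ℝ) < s + t) :
    ∃ K : ℝ, 0 ≤ K ∧ ∀ (m : V → ℂ) (b : V) (κ : ℝ), Integrable m → 0 ≤ κ →
      (∀ r : ℝ, 0 < r → (volume.withDensity fun y => ‖𝓕⁻ m y‖ₑ ^ 2) (Metric.closedBall b r) ≤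
        ENNReal.ofReal (κ * r ^ t)) →
      ‖∫ ξ, Complex.exp (2 * Real.pi * Complex.I * inner ℝ b ξ) *
        (((1 + ‖ξ‖ ^ 2) ^ (-(s / 4)) : ℝ) * m ξ)‖ ≤ K * √κ := by
  set n : ℝ := (Module.finrank ℝ V : ℝ)
  have ha : 0 < s / 4 := by positivity
  have ha' : 0 < s / 4 + (t - n) / 4 := by linarith
  set c : ℝ := Real.pi ^ (s / 4) / Real.Gamma (s / 4) with hc
  have hc0 : 0 ≤ c := by have := Real.Gamma_pos_of_pos ha; positivity
  set J : ℝ := ∫ u in Set.Ioi (0 : ℝ), u ^ (s / 4 + (t - n) / 4 - 1) * Real.exp (-(Real.pi * u))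
  have hJ : 0 ≤ J := setIntegral_nonneg measurableSet_Ioi fun u (hu : 0 < u) => by positivity
  refine ⟨c * (√(gaussMoment t) * J), by positivity, fun m b κ hm hκ hρ => ?_⟩
  -- `w u ξ` is the integrand after expanding the Bessel multiplier into Gaussians
  set w : V → ℝ → ℂ := fun ξ u =>
    ((u ^ (s / 4 - 1) * Real.exp (-(Real.pi * u)) : ℝ) : ℂ) * (modGauss u b ξ * m ξ) with hw
  have hw1 : ∀ ξ, Complex.exp (2 * Real.pi * Complex.I * inner ℝ b ξ) *
      (((1 + ‖ξ‖ ^ 2) ^ (-(s / 4)) : ℝ) * m ξ) = c * ∫ u in Set.Ioi (0 : ℝ), w ξ u := by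
    intro ξ
    have : ∀ u : ℝ, w ξ u =
        ((u ^ (s / 4 - 1) * Real.exp (-(Real.pi * (1 + ‖ξ‖ ^ 2) * u)) : ℝ) : ℂ) *
        (Complex.exp (2 * Real.pi * Complex.I * inner ℝ b ξ) * m ξ) := by
      intro u
      have : Real.exp (-(Real.pi * (1 + ‖ξ‖ ^ 2) * u)) =
          Real.exp (-(Real.pi * u)) * Real.exp (-(Real.pi * u) * ‖ξ‖ ^ 2) := by
        rw [← Real.exp_add]; congr 1; ring
      rw [hw, this]
      simp only [modGauss_eq]
      push_cast
      ring
    simp only [this]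
    rw [integral_mul_const, one_add_sq_rpow_neg_eq_integral ha ξ, integral_complex_ofReal, ← hc,
      Complex.ofReal_mul]
    ring
  have hwint : Integrable (Function.uncurry w)
      (volume.prod (volume.restrict (Set.Ioi (0 : ℝ)))) := by
    have hdom := hm.norm.mul_prod (integrableOn_rpow_mul_exp_neg_pi ha)
    refine hdom.mono' ?_ ?_
    · have h1 : Measurable fun p : V × ℝ =>
          ((p.2 ^ (s / 4 - 1) * Real.exp (-(Real.pi * p.2)) : ℝ) : ℂ) * modGauss p.2 b p.1 := by
        unfold modGauss; fun_prop
      refine (h1.aestronglyMeasurable.mul hm.1.comp_fst).congr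
        (Filter.Eventually.of_forall fun p => ?_)
      simp only [Function.uncurry, hw, Pi.mul_apply]
      ring
    · have hmem : ∀ᵐ p : V × ℝ ∂(volume.prod (volume.restrict (Set.Ioi (0 : ℝ)))), 0 < p.2 :=
        Measure.quasiMeasurePreserving_snd.ae (ae_restrict_mem measurableSet_Ioi)
      filter_upwards [hmem] with p hp
      simp only [Function.uncurry, hw, norm_mul, Complex.norm_real, norm_modGauss]
      rw [Real.norm_of_nonneg (by positivity), Real.norm_of_nonneg (Real.exp_nonneg _), mul_comm]
      gcongr
      refine mul_le_of_le_one_left (norm_nonneg _) (Real.exp_le_one_iff.2 ?_)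
      have : 0 ≤ Real.pi * p.2 * ‖p.1‖ ^ 2 := by positivity
      linarith
  simp only [hw1]
  rw [integral_const_mul, integral_integral_swap hwint, norm_mul, Complex.norm_real,
    Real.norm_of_nonneg hc0]
  have hbound : ‖∫ u in Set.Ioi (0 : ℝ), ∫ ξ, w ξ u‖ ≤ √(κ * gaussMoment t) * J := by
    rw [← integral_const_mul]
    refine norm_integral_le_of_norm_le ((integrableOn_rpow_mul_exp_neg_pi ha').const_mul _) ?_
    filter_upwards [ae_restrict_mem measurableSet_Ioi] with u (hu : 0 < u)
    simp only [hw]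
    rw [integral_const_mul, norm_mul, Complex.norm_real, Real.norm_of_nonneg (by positivity)]
    have := norm_integral_modGauss_mul_le hm hκ hu hρ
    calc _ ≤ u ^ (s / 4 - 1) * Real.exp (-(Real.pi * u)) *
          (√(κ * gaussMoment t) * u ^ ((t - n) / 4)) := by gcongr
      _ = _ := by
        rw [show s / 4 + (t - n) / 4 - 1 = (s / 4 - 1) + (t - n) / 4 by ring, Real.rpow_add hu]
        ring
  calc _ ≤ c * (√(κ * gaussMoment t) * J) := by gcongr
    _ = _ := by rw [Real.sqrt_mul hκ]; ring

end Bessel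

/-! ### A covering criterion for vanishing Hausdorff measure -/

section Covering

/-- By Vitali's covering theorem, a set is null for the `t`-dimensional Hausdorff measure if there
are measures of arbitrarily small mass which give every point of the set a ball of radius `r` and
mass at least `κ r^t`, for some `r` depending on the point. -/
theorem hausdorffMeasure_eq_zero_of_exists_measure {X : Type*} [MetricSpace X]
    [SecondCountableTopology X] [MeasurableSpace X] [BorelSpace X] {B : Set X} {t κ : ℝ}
    (ht : 0 < t) (hκ : 0 < κ)
    (h : ∀ η : ℝ, 0 < η → ∃ ρ : Measure X, ρ Set.univ ≤ ENNReal.ofReal η ∧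
      ∀ b ∈ B, ∃ r : ℝ, 0 < r ∧ ENNReal.ofReal (κ * r ^ t) ≤ ρ (Metric.closedBall b r)) :
    μH[t] B = 0 := by
  choose! ρ hρ r hr0 hr using fun k : ℕ => h (1 / ((k : ℝ) + 1)) Nat.one_div_pos_of_nat
  -- the radii at stage `k` are at most `R k`
  set R : ℕ → ℝ := fun k => (1 / ((k : ℝ) + 1) / κ) ^ t⁻¹ with hR
  have hrR : ∀ k, ∀ b ∈ B, r k b ≤ R k := by
    intro k b hb
    have h1 := ((hr k b hb).trans (measure_mono (Set.subset_univ _))).trans (hρ k)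
    rw [ENNReal.ofReal_le_ofReal_iff (by positivity), mul_comm, ← le_div_iff₀ hκ] at h1
    have h2 := Real.rpow_le_rpow (Real.rpow_nonneg (hr0 k b hb).le t) h1 (inv_nonneg.2 ht.le)
    rwa [Real.rpow_rpow_inv (hr0 k b hb).le ht.ne'] at h2
  have hRlim : Filter.Tendsto R Filter.atTop (nhds 0) := by
    have h1 := (tendsto_one_div_add_atTop_nhds_zero_nat (𝕜 := ℝ)).div_const κ
    have h2 := h1.rpow_const (p := t⁻¹) (Or.inr (inv_nonneg.2 ht.le))
    rwa [zero_div, Real.zero_rpow (inv_pos.2 ht).ne'] at h2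
  choose u huB hudisj hucov using fun k : ℕ =>
    Vitali.exists_disjoint_subfamily_covering_enlargement_closedBall B (fun b => b) (r k) (R k)
      (hrR k) 5 (by norm_num)
  have hucount : ∀ k, (u k).Countable := fun k =>
    (hudisj k).countable_of_nonempty_interior fun b hb =>
      ⟨b, Metric.ball_subset_interior_closedBall
        (Metric.mem_ball_self (hr0 k b (huB k hb)))⟩
  have : ∀ k, Countable (u k) := fun k => (hucount k).to_subtype
  have hdiam : ∀ k, ∀ b ∈ B,
      Metric.ediam (Metric.closedBall b (5 * r k b)) ≤ ENNReal.ofReal (10 * r k b) := by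
    intro k b hb
    refine Metric.ediam_le_of_forall_dist_le fun x hx y hy => ?_
    rw [Metric.mem_closedBall] at hx hy
    linarith [dist_triangle_right x y b]
  have hle := Measure.hausdorffMeasure_le_liminf_tsum (ι := fun k => u k) t B (l := Filter.atTop)
    (fun k => ENNReal.ofReal (10 * R k)) (by
      have := ENNReal.tendsto_ofReal (hRlim.const_mul 10)
      simpa using this)
    (fun k b => Metric.closedBall (b : X) (5 * r k b))
    (Filter.Eventually.of_forall fun k b => (hdiam k b (huB k b.2)).trans
      (ENNReal.ofReal_le_ofReal (by linarith [hrR k b (huB k b.2)])))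
    (Filter.Eventually.of_forall fun k x hx => by
      obtain ⟨b, hb, hsub⟩ := hucov k x hx
      exact Set.mem_iUnion.2 ⟨⟨b, hb⟩, hsub (Metric.mem_closedBall_self (hr0 k x hx).le)⟩)
  have hsum : ∀ k, ∑' b : u k, Metric.ediam (Metric.closedBall (b : X) (5 * r k b)) ^ t ≤
      ENNReal.ofReal (10 ^ t / κ) * ENNReal.ofReal (1 / ((k : ℝ) + 1)) := by
    intro k
    calc _ ≤ ∑' b : u k, ENNReal.ofReal (10 ^ t / κ) * ρ k (Metric.closedBall (b : X) (r k b)) := by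
          refine ENNReal.tsum_le_tsum fun b => ?_
          have hb := huB k b.2
          have hb0 := (hr0 k b hb).le
          refine (ENNReal.rpow_le_rpow (hdiam k b hb) ht.le).trans ?_
          refine le_trans ?_ (mul_le_mul_right (hr k b hb) _)
          rw [ENNReal.ofReal_rpow_of_nonneg (by positivity) ht.le,
            ← ENNReal.ofReal_mul (by positivity), Real.mul_rpow (by norm_num) hb0]
          refine ENNReal.ofReal_le_ofReal (le_of_eq ?_)
          field_simp
      _ = ENNReal.ofReal (10 ^ t / κ) * ρ k (⋃ b : u k, Metric.closedBall (b : X) (r k b)) := by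
          rw [ENNReal.tsum_mul_left, measure_iUnion
            (f := fun b : u k => Metric.closedBall (b : X) (r k b))
            (fun a b hab => hudisj k a.2 b.2 (Subtype.coe_injective.ne hab))
            (fun b => Metric.isClosed_closedBall.measurableSet)]
      _ ≤ _ := mul_le_mul_right ((measure_mono (Set.subset_univ _)).trans (hρ k)) _
  have hlim : Filter.Tendsto (fun k : ℕ =>
      ENNReal.ofReal (10 ^ t / κ) * ENNReal.ofReal (1 / ((k : ℝ) + 1))) Filter.atTop (nhds 0) := by
    have h1 := ENNReal.tendsto_ofReal (tendsto_one_div_add_atTop_nhds_zero_nat (𝕜 := ℝ))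
    have h2 := ENNReal.Tendsto.const_mul (a := ENNReal.ofReal (10 ^ t / κ)) h1
      (Or.inr ENNReal.ofReal_ne_top)
    simpa using h2
  refine le_antisymm (hle.trans ?_) zero_le
  rw [← hlim.liminf_eq]
  exact Filter.liminf_le_liminf (Filter.Eventually.of_forall hsum)

end Covering

/-! ### Concentration of the heat kernel -/

section Concentration

variable {V : Type*} [NormedAddCommGroup V] [InnerProductSpace ℝ V] [FiniteDimensional ℝ V]
  [MeasurableSpace V] [BorelSpace V]

theorem exists_half_le_setIntegral_heatKernel {ε : ℝ} (hε : 0 < ε) :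
    ∃ δ : ℝ, 0 < δ ∧ ∀ c : V, 1 / 2 ≤ ∫ x in Metric.ball c ε, heatKernel δ (c - x) := by
  set D : ℝ := 2 ^ (Module.finrank ℝ V / 2 : ℝ) with hD
  have hD1 : 1 ≤ D := Real.one_le_rpow (by norm_num) (by positivity)
  have hL : 0 < Real.log (2 * D) := Real.log_pos (by linarith)
  set δ : ℝ := Real.pi * ε ^ 2 / (2 * Real.log (2 * D)) with hδdef
  have hδ : 0 < δ := by positivity
  refine ⟨δ, hδ, fun c => ?_⟩
  have hint : ∀ {u : ℝ}, 0 < u → Integrable fun x : V => heatKernel u (c - x) :=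
    fun hu => (integrable_heatKernel hu).comp_sub_left c
  have htot : ∀ {u : ℝ}, 0 < u → ∫ x : V, heatKernel u (c - x) = 1 := fun {u} hu => by
    rw [integral_sub_left_eq_self (fun y => heatKernel u y), integral_heatKernel hu]
  have hsplit := integral_add_compl (Metric.isOpen_ball (x := c) (ε := ε)).measurableSet (hint hδ)
  rw [htot hδ] at hsplit
  -- away from the ball, half of the Gaussian exponent is spent on a small constant
  have hpt : ∀ x ∈ (Metric.ball c ε)ᶜ,
      heatKernel δ (c - x) ≤ 1 / 2 * heatKernel (2 * δ) (c - x) := by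
    intro x hx
    have hx' : ε ≤ ‖c - x‖ := by
      rw [Set.mem_compl_iff, Metric.mem_ball, not_lt, dist_comm, dist_eq_norm] at hx
      exact hx
    have hexp : Real.exp (-(Real.pi / δ) * ‖c - x‖ ^ 2) ≤
        (2 * D)⁻¹ * Real.exp (-(Real.pi / (2 * δ)) * ‖c - x‖ ^ 2) := by
      rw [← Real.exp_log (show 0 < (2 * D)⁻¹ by positivity), Real.log_inv, ← Real.exp_add,
        Real.exp_le_exp]
      have h1 : Real.log (2 * D) = Real.pi / (2 * δ) * ε ^ 2 := by
        rw [hδdef]; field_simp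
      have h2 : Real.pi / δ = Real.pi / (2 * δ) + Real.pi / (2 * δ) := by field_simp; norm_num
      have h3 : Real.pi / (2 * δ) * ε ^ 2 ≤ Real.pi / (2 * δ) * ‖c - x‖ ^ 2 := by gcongr
      rw [h1, h2]
      linarith
    have hpow : (2 * δ) ^ (-(Module.finrank ℝ V / 2 : ℝ)) =
        D⁻¹ * δ ^ (-(Module.finrank ℝ V / 2 : ℝ)) := by
      rw [Real.mul_rpow (by norm_num) hδ.le, Real.rpow_neg (by norm_num)]
    unfold heatKernel
    rw [hpow]
    calc _ ≤ δ ^ (-(Module.finrank ℝ V / 2 : ℝ)) *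
          ((2 * D)⁻¹ * Real.exp (-(Real.pi / (2 * δ)) * ‖c - x‖ ^ 2)) := by gcongr
      _ = _ := by rw [mul_inv]; ring
  have hcompl : ∫ x in (Metric.ball c ε)ᶜ, heatKernel δ (c - x) ≤ 1 / 2 := by
    calc _ ≤ ∫ x in (Metric.ball c ε)ᶜ, 1 / 2 * heatKernel (2 * δ) (c - x) :=
          setIntegral_mono_on (hint hδ).integrableOn ((hint (by positivity)).const_mul _).integrableOn
            Metric.isOpen_ball.measurableSet.compl hpt
      _ ≤ ∫ x, 1 / 2 * heatKernel (2 * δ) (c - x) :=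
          setIntegral_le_integral ((hint (by positivity)).const_mul _)
            (Filter.Eventually.of_forall fun x =>
              mul_nonneg (by norm_num) (heatKernel_nonneg (by positivity) _))
      _ = 1 / 2 := by rw [integral_const_mul, htot (by positivity), mul_one]
  linarith

end Concentration

/-! ### Sums of compact sets -/

section Sumset

open FourierTransform

variable {d : ℕ}

theorem continuous_measureFourier (μ : Measure (EuclideanSpace ℝ (Fin d))) [IsFiniteMeasure μ] :
    Continuous (measureFourier μ) := by
  refine continuous_of_dominated (bound := fun _ => (1 : ℝ)) (fun ξ => ?_) (fun ξ => ?_)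
    (integrable_const _) ?_
  · exact Continuous.aestronglyMeasurable (by fun_prop)
  · refine Filter.Eventually.of_forall fun x => le_of_eq ?_
    rw [Complex.norm_exp]
    simp
  · exact Filter.Eventually.of_forall fun x => by fun_prop

theorem norm_measureFourier_le (μ : Measure (EuclideanSpace ℝ (Fin d))) [IsFiniteMeasure μ]
    (ξ : EuclideanSpace ℝ (Fin d)) : ‖measureFourier μ ξ‖ ≤ μ.real Set.univ := by
  refine (norm_integral_le_of_norm_le (integrable_const (1 : ℝ))
    (Filter.Eventually.of_forall fun x => le_of_eq ?_)).trans (le_of_eq (by simp))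
  rw [Complex.norm_exp]
  simp

/-- Decay of the Fourier transform of a finite measure against the homogeneous weight `|ξ|^s`
gives decay against the inhomogeneous weight `(1 + |ξ|²)^(s/2)`. -/
theorem exists_measureFourier_sq_mul_le (μ : Measure (EuclideanSpace ℝ (Fin d)))
    [IsFiniteMeasure μ] {s C : ℝ} (hs : 0 < s)
    (hC : ∀ ξ, ‖measureFourier μ ξ‖ ^ 2 * ‖ξ‖ ^ s ≤ C) :
    ∃ C' : ℝ, 0 ≤ C' ∧ ∀ ξ, ‖measureFourier μ ξ‖ ^ 2 * (1 + ‖ξ‖ ^ 2) ^ (s / 2) ≤ C' := by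
  have hC0 : 0 ≤ C := le_trans (by positivity) (hC 0)
  refine ⟨2 ^ (s / 2) * (μ.real Set.univ ^ 2 + C), by positivity, fun ξ => ?_⟩
  rcases le_total ‖ξ‖ 1 with h | h
  · have h1 : (1 + ‖ξ‖ ^ 2) ^ (s / 2) ≤ 2 ^ (s / 2) :=
      Real.rpow_le_rpow (by positivity) (by nlinarith [norm_nonneg ξ]) (by positivity)
    have h2 : ‖measureFourier μ ξ‖ ^ 2 ≤ μ.real Set.univ ^ 2 := by
      gcongr; exact norm_measureFourier_le μ ξ
    calc _ ≤ μ.real Set.univ ^ 2 * 2 ^ (s / 2) := by gcongr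
      _ = 2 ^ (s / 2) * (μ.real Set.univ ^ 2) := mul_comm _ _
      _ ≤ _ := by gcongr; linarith
  · have h1 : (1 + ‖ξ‖ ^ 2) ^ (s / 2) ≤ 2 ^ (s / 2) * ‖ξ‖ ^ s := by
      calc _ ≤ (2 * ‖ξ‖ ^ 2) ^ (s / 2) :=
            Real.rpow_le_rpow (by positivity) (by nlinarith) (by positivity)
        _ = _ := by
            rw [Real.mul_rpow (by norm_num) (by positivity), ← Real.rpow_natCast,
              ← Real.rpow_mul (norm_nonneg _)]
            congr 2
            push_cast
            ring
    calc _ ≤ ‖measureFourier μ ξ‖ ^ 2 * (2 ^ (s / 2) * ‖ξ‖ ^ s) := by gcongr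
      _ = 2 ^ (s / 2) * (‖measureFourier μ ξ‖ ^ 2 * ‖ξ‖ ^ s) := by ring
      _ ≤ 2 ^ (s / 2) * (μ.real Set.univ ^ 2 + C) := by
        gcongr
        linarith [hC ξ, sq_nonneg (μ.real Set.univ)]

theorem integrable_indicator_one {U : Set (EuclideanSpace ℝ (Fin d))} (hU : MeasurableSet U)
    (hUfin : volume U ≠ ∞) : Integrable (U.indicator fun _ => (1 : ℂ)) :=
  (integrable_indicator_iff hU).2 (integrableOn_const hUfin)

theorem norm_fourier_indicator_le {U : Set (EuclideanSpace ℝ (Fin d))} (hU : MeasurableSet U)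
    (ξ : EuclideanSpace ℝ (Fin d)) :
    ‖𝓕 (U.indicator fun _ => (1 : ℂ)) ξ‖ ≤ volume.real U := by
  refine (VectorFourier.norm_fourierIntegral_le_integral_norm _ _ _ _ _).trans (le_of_eq ?_)
  simp only [norm_indicator_eq_indicator_norm, norm_one]
  rw [integral_indicator hU]
  simp

/-- Both sides are the value at `b` of `μ̃ * 1_U * p_δ`, where `μ̃` is the reflection of `μ` and
`p_δ` the heat kernel: on the Fourier side, and in physical space. -/
theorem integral_modGauss_mul_measureFourier (μ : Measure (EuclideanSpace ℝ (Fin d)))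
    [IsFiniteMeasure μ] {U : Set (EuclideanSpace ℝ (Fin d))} (hU : MeasurableSet U)
    (hUfin : volume U ≠ ∞) {δ : ℝ} (hδ : 0 < δ) (b : EuclideanSpace ℝ (Fin d)) :
    ∫ ξ, modGauss δ b ξ * (measureFourier μ (-ξ) * 𝓕 (U.indicator fun _ => (1 : ℂ)) ξ) =
      ((∫ a, (∫ x in U, heatKernel δ (a + b - x)) ∂μ : ℝ) : ℂ) := by
  have hfint := integrable_indicator_one hU hUfin
  set f : EuclideanSpace ℝ (Fin d) → ℂ := U.indicator fun _ => (1 : ℂ) with hf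
  have h1 : ∀ ξ, modGauss δ b ξ * (measureFourier μ (-ξ) * 𝓕 f ξ) =
      ∫ a, modGauss δ (a + b) ξ * 𝓕 f ξ ∂μ := by
    intro ξ
    have : ∀ a, modGauss δ (a + b) ξ * 𝓕 f ξ = modGauss δ b ξ *
        (Complex.exp (-(2 * (Real.pi : ℂ) * Complex.I * ((inner ℝ a (-ξ) : ℝ) : ℂ))) * 𝓕 f ξ) := by
      intro a
      rw [← mul_assoc]
      congr 1
      simp only [modGauss]
      rw [← Complex.exp_add]
      congr 1
      rw [inner_neg_right, inner_add_left]
      push_cast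
      ring
    simp only [this]
    rw [integral_const_mul, integral_mul_const, measureFourier]
  have hint : Integrable (Function.uncurry fun ξ a => modGauss δ (a + b) ξ * 𝓕 f ξ)
      (volume.prod μ) := by
    have hdom := ((integrable_modGauss hδ (0 : EuclideanSpace ℝ (Fin d))).norm.mul_const
      (volume.real U)).mul_prod (integrable_const (μ := μ) (1 : ℝ))
    refine hdom.mono' ?_ (Filter.Eventually.of_forall fun p => ?_)
    · have hc := continuous_fourier_of_integrable hfint
      refine Continuous.aestronglyMeasurable ?_
      unfold modGauss Function.uncurry
      fun_prop
    · simp only [Function.uncurry, norm_mul, norm_modGauss, mul_one]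
      gcongr
      exact norm_fourier_indicator_le hU _
  simp only [h1]
  rw [integral_integral_swap hint, ← integral_complex_ofReal]
  refine integral_congr_ae (Filter.Eventually.of_forall fun a => ?_)
  refine (integral_modGauss_mul_fourier hδ _ hfint).trans ?_
  beta_reduce
  rw [← integral_complex_ofReal, ← integral_indicator hU]
  refine integral_congr_ae (Filter.Eventually.of_forall fun x => ?_)
  by_cases hx : x ∈ U <;> simp [hf, hx]

/-- If `U` contains the `ε`-neighbourhood of `A + B`, then `μ̃ * 1_U * p_δ` is bounded below
on `B` for small `δ`. -/
theorem exists_half_measure_le_integral {μ : Measure (EuclideanSpace ℝ (Fin d))} [IsFiniteMeasure μ]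
    {A B U : Set (EuclideanSpace ℝ (Fin d))} (hμA : ∀ᵐ a ∂μ, a ∈ A)
    {ε : ℝ} (hε : 0 < ε) (hsub : Metric.thickening ε (A + B) ⊆ U) :
    ∃ δ : ℝ, 0 < δ ∧ ∀ b ∈ B,
      μ.real Set.univ / 2 ≤ ∫ a, (∫ x in U, heatKernel δ (a + b - x)) ∂μ := by
  obtain ⟨δ, hδ, hhalf⟩ := exists_half_le_setIntegral_heatKernel (V := EuclideanSpace ℝ (Fin d)) hε
  refine ⟨δ, hδ, fun b hb => ?_⟩
  have hint : ∀ c : EuclideanSpace ℝ (Fin d), Integrable fun x => heatKernel δ (c - x) :=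
    fun c => (integrable_heatKernel hδ).comp_sub_left c
  have hnn : ∀ c : EuclideanSpace ℝ (Fin d), 0 ≤ fun x => heatKernel δ (c - x) :=
    fun c x => heatKernel_nonneg hδ _
  have hle1 : ∀ c : EuclideanSpace ℝ (Fin d), ∫ x in U, heatKernel δ (c - x) ≤ 1 := fun c => by
    refine (setIntegral_le_integral (hint c) (Filter.Eventually.of_forall (hnn c))).trans ?_
    rw [integral_sub_left_eq_self (fun y => heatKernel δ y), integral_heatKernel hδ]
  have hmeas : AEStronglyMeasurable (fun a => ∫ x in U, heatKernel δ (a + b - x)) μ := by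
    refine StronglyMeasurable.aestronglyMeasurable ?_
    refine StronglyMeasurable.integral_prod_right'
      (f := fun p : EuclideanSpace ℝ (Fin d) × EuclideanSpace ℝ (Fin d) =>
        heatKernel δ (p.1 + b - p.2)) ?_
    exact ((continuous_heatKernel δ).comp (by fun_prop)).stronglyMeasurable
  have hI : Integrable (fun a => ∫ x in U, heatKernel δ (a + b - x)) μ := by
    refine (integrable_const (1 : ℝ)).mono' hmeas (Filter.Eventually.of_forall fun a => ?_)
    rw [Real.norm_of_nonneg (integral_nonneg (hnn _))]
    exact hle1 _
  calc μ.real Set.univ / 2 = ∫ _, (1 / 2 : ℝ) ∂μ := by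
        rw [integral_const, smul_eq_mul]; ring
    _ ≤ _ := by
      refine integral_mono_ae (f := fun _ => (1 / 2 : ℝ)) (integrable_const _) hI ?_
      filter_upwards [hμA] with a ha
      refine (hhalf (a + b)).trans (setIntegral_mono_set (hint _).integrableOn
        (Filter.Eventually.of_forall (hnn _)) (LE.le.eventuallyLE ?_))
      exact (Metric.ball_subset_thickening (Set.add_mem_add ha hb) ε).trans hsub

/-- If `μ` is carried by `A`, its Fourier transform decays of order `s / 2`, and `A + B` is a
Lebesgue-null compact set, then `B` is null for the Hausdorff measure of every dimension
`t > d - s`. -/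
theorem hausdorffMeasure_eq_zero_of_volume_add_eq_zero
    {μ : Measure (EuclideanSpace ℝ (Fin d))} [IsFiniteMeasure μ] (hμ0 : μ ≠ 0)
    {A B : Set (EuclideanSpace ℝ (Fin d))} (hμA : ∀ᵐ a ∂μ, a ∈ A)
    (hAB : IsCompact (A + B)) (hnull : volume (A + B) = 0) {s t C : ℝ} (hs : 0 < s) (ht : 0 < t)
    (hst : (d : ℝ) < s + t) (hC : ∀ ξ, ‖measureFourier μ ξ‖ ^ 2 * ‖ξ‖ ^ s ≤ C) :
    μH[t] B = 0 := by
  obtain ⟨C', hC'0, hC'⟩ := exists_measureFourier_sq_mul_le μ hs hC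
  obtain ⟨K, hK0, hK⟩ := exists_norm_integral_bessel_le (V := EuclideanSpace ℝ (Fin d)) hs
    (t := t) (by simpa using hst)
  have hM : 0 < μ.real Set.univ := by
    have := NeZero.mk hμ0
    exact measureReal_univ_pos
  set M := μ.real Set.univ
  -- with this `κ`, growth `κ r^t` at `b` would force a potential of size `K √κ < M / 2` at `b`
  set κ : ℝ := (M / (4 * (K + 1))) ^ 2 with hκdef
  have hκ : 0 < κ := by positivity
  have hKκ : K * √κ < M / 2 := by
    rw [hκdef, Real.sqrt_sq (by positivity), ← mul_div_assoc,
      div_lt_div_iff₀ (by positivity) two_pos]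
    nlinarith
  refine hausdorffMeasure_eq_zero_of_exists_measure ht hκ fun η hη => ?_
  obtain ⟨U, hABU, hUo, hUvol⟩ := Set.exists_isOpen_lt_of_lt (A + B) (ENNReal.ofReal (η / (C' + 1)))
    (by rw [hnull]; exact ENNReal.ofReal_pos.2 (by positivity))
  have hU := hUo.measurableSet
  have hUfin : volume U ≠ ∞ := hUvol.ne_top
  obtain ⟨ε, hε, hsub⟩ := hAB.exists_thickening_subset_open hUo hABU
  obtain ⟨δ, hδ, hlow⟩ := exists_half_measure_le_integral hμA hε hsub
  have hfint := integrable_indicator_one hU hUfin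
  have hfL2 : MemLp (U.indicator fun _ => (1 : ℂ)) 2
      (volume : Measure (EuclideanSpace ℝ (Fin d))) :=
    memLp_indicator_const 2 hU 1 (Or.inr hUfin)
  set f : EuclideanSpace ℝ (Fin d) → ℂ := U.indicator fun _ => (1 : ℂ) with hf
  have hfF := lintegral_fourier_sq hfint hfL2
  have hfvol : ∫⁻ x, ‖f x‖ₑ ^ 2 = volume U := by
    rw [← lintegral_indicator_one hU]
    refine lintegral_congr fun x => ?_
    by_cases hx : x ∈ U <;> simp [hf, hx]
  -- `m` is the Fourier transform of the function whose Bessel potential is `μ̃ * 1_U * p_δ`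
  set m : EuclideanSpace ℝ (Fin d) → ℂ := fun ξ =>
    (((1 + ‖ξ‖ ^ 2) ^ (s / 4) * Real.exp (-(Real.pi * δ) * ‖ξ‖ ^ 2) : ℝ) : ℂ) *
      (measureFourier μ (-ξ) * 𝓕 f ξ) with hm
  have hmsq : ∀ ξ, ‖m ξ‖ ^ 2 ≤
      C' * ‖𝓕 f ξ‖ ^ 2 * Real.exp (-(Real.pi * δ) * ‖ξ‖ ^ 2) ^ 2 := by
    intro ξ
    have h1 : (0 : ℝ) ≤ 1 + ‖ξ‖ ^ 2 := by positivity
    have h2 : ((1 + ‖ξ‖ ^ 2) ^ (s / 4)) ^ 2 = (1 + ‖ξ‖ ^ 2) ^ (s / 2) := by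
      rw [← Real.rpow_natCast, ← Real.rpow_mul h1]
      congr 1; push_cast; ring
    have h3 := hC' (-ξ)
    rw [norm_neg] at h3
    simp only [hm, norm_mul, Complex.norm_real]
    rw [Real.norm_of_nonneg (by positivity), Real.norm_of_nonneg (Real.exp_nonneg _)]
    calc _ = (‖measureFourier μ (-ξ)‖ ^ 2 * ((1 + ‖ξ‖ ^ 2) ^ (s / 4)) ^ 2) * ‖𝓕 f ξ‖ ^ 2 *
          Real.exp (-(Real.pi * δ) * ‖ξ‖ ^ 2) ^ 2 := by ring
      _ ≤ _ := by rw [h2]; gcongr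
  have hmcont : Continuous m := by
    have h1 := continuous_fourier_of_integrable hfint
    have h2 := continuous_measureFourier μ
    have h3 : Continuous fun ξ : EuclideanSpace ℝ (Fin d) => (1 + ‖ξ‖ ^ 2) ^ (s / 4) :=
      Continuous.rpow_const (by fun_prop) fun ξ => Or.inr (by positivity)
    fun_prop
  set g : EuclideanSpace ℝ (Fin d) → ℝ := fun ξ => Real.exp (-(Real.pi * δ) * ‖ξ‖ ^ 2) with hg
  have hgint : Integrable g := by
    have := (integrable_modGauss hδ (0 : EuclideanSpace ℝ (Fin d))).norm
    simpa only [norm_modGauss] using this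
  have hmg : ∀ ξ, ‖m ξ‖ ^ 2 ≤ (√C' * volume.real U * g ξ) ^ 2 := by
    intro ξ
    refine (hmsq ξ).trans ?_
    rw [mul_pow, mul_pow, Real.sq_sqrt hC'0]
    gcongr
    exact norm_fourier_indicator_le hU ξ
  have hmint : Integrable m := by
    refine (hgint.const_mul (√C' * volume.real U)).mono' hmcont.aestronglyMeasurable
      (Filter.Eventually.of_forall fun ξ => ?_)
    exact le_of_sq_le_sq (hmg ξ) (by positivity)
  have hmL2 : MemLp m 2 := by
    rw [memLp_two_iff_integrable_sq_norm hmcont.aestronglyMeasurable]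
    refine (hgint.const_mul ((√C' * volume.real U) ^ 2)).mono'
      (hmcont.norm.pow 2).aestronglyMeasurable (Filter.Eventually.of_forall fun ξ => ?_)
    rw [Real.norm_of_nonneg (by positivity)]
    refine (hmg ξ).trans ?_
    rw [mul_pow]
    have hg1 : g ξ ≤ 1 := Real.exp_le_one_iff.2 (by
      have : 0 ≤ Real.pi * δ * ‖ξ‖ ^ 2 := by positivity
      linarith)
    gcongr
    exact pow_le_of_le_one (Real.exp_nonneg _) hg1 two_ne_zero
  refine ⟨volume.withDensity fun y => ‖𝓕⁻ m y‖ₑ ^ 2, ?_, fun b hb => ?_⟩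
  · rw [withDensity_apply _ MeasurableSet.univ, Measure.restrict_univ,
      lintegral_fourierInv_sq hmint hmL2]
    calc ∫⁻ ξ, ‖m ξ‖ₑ ^ 2 ≤ ∫⁻ ξ, ENNReal.ofReal C' * ‖𝓕 f ξ‖ₑ ^ 2 := by
          refine lintegral_mono fun ξ => ?_
          simp only [← ofReal_norm]
          rw [← ENNReal.ofReal_pow (norm_nonneg _), ← ENNReal.ofReal_pow (norm_nonneg _),
            ← ENNReal.ofReal_mul hC'0]
          refine ENNReal.ofReal_le_ofReal
            ((hmsq ξ).trans (mul_le_of_le_one_right (by positivity) ?_))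
          refine pow_le_one₀ (Real.exp_nonneg _) (Real.exp_le_one_iff.2 ?_)
          have : 0 ≤ Real.pi * δ * ‖ξ‖ ^ 2 := by positivity
          linarith
      _ = ENNReal.ofReal C' * volume U := by
          rw [lintegral_const_mul' _ _ ENNReal.ofReal_ne_top, hfF, hfvol]
      _ ≤ ENNReal.ofReal C' * ENNReal.ofReal (η / (C' + 1)) := by gcongr
      _ ≤ ENNReal.ofReal η := by
          rw [← ENNReal.ofReal_mul hC'0]
          refine ENNReal.ofReal_le_ofReal ?_
          rw [← mul_div_assoc, div_le_iff₀ (by positivity)]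
          nlinarith
  · by_contra! hcon
    have hpot := hK m b κ hmint hκ.le fun r hr => (hcon r hr).le
    have heq : ∀ ξ, Complex.exp (2 * Real.pi * Complex.I * inner ℝ b ξ) *
        (((1 + ‖ξ‖ ^ 2) ^ (-(s / 4)) : ℝ) * m ξ) =
        modGauss δ b ξ * (measureFourier μ (-ξ) * 𝓕 f ξ) := by
      intro ξ
      have h1 : 0 < 1 + ‖ξ‖ ^ 2 := by positivity
      have h2 : (((1 + ‖ξ‖ ^ 2) ^ (-(s / 4)) : ℝ) : ℂ) * (((1 + ‖ξ‖ ^ 2) ^ (s / 4) : ℝ) : ℂ) = 1 := by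
        rw [← Complex.ofReal_mul, ← Real.rpow_add h1, neg_add_cancel, Real.rpow_zero,
          Complex.ofReal_one]
      rw [modGauss_eq, hm]
      simp only [Complex.ofReal_mul]
      linear_combination (Complex.exp (2 * Real.pi * Complex.I * inner ℝ b ξ) *
        (Real.exp (-(Real.pi * δ) * ‖ξ‖ ^ 2) : ℂ) * (measureFourier μ (-ξ) * 𝓕 f ξ)) * h2
    simp only [heq] at hpot
    rw [integral_modGauss_mul_measureFourier μ hU hUfin hδ b, Complex.norm_real] at hpot
    have := (hlow b hb).trans (Real.le_norm_self _)
    linarith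

/-- The sum of two compact sets has positive Lebesgue measure if the Fourier dimension of one and
the Hausdorff dimension of the other add up to more than the dimension of the space. -/
theorem volume_add_pos_of_lt_fourierDim_add_dimH {A B : Set (EuclideanSpace ℝ (Fin d))}
    (hA : IsCompact A) (hB : IsCompact B) (h : (d : ℝ≥0∞) < fourierDim A + dimH B) :
    0 < volume (A + B) := by
  by_contra hcon
  have hnull : volume (A + B) = 0 := by simpa using hcon
  have hBd : dimH B ≤ d := by
    have := (dimH_mono (Set.subset_univ B)).trans_eq (Real.dimH_univ_eq_finrank _)
    simpa using this
  have h1 : (d : ℝ≥0∞) - dimH B < fourierDim A :=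
    (ENNReal.sub_lt_iff_lt_right (ne_top_of_le_ne_top (ENNReal.natCast_ne_top d) hBd) hBd).2 h
  obtain ⟨_, ⟨s, rfl, hsd, μ, hμ, C, hC⟩, hs⟩ := lt_sSup_iff.1 h1
  have hsd' : (s : ℝ≥0∞) ≤ d := by exact_mod_cast hsd
  have h2 : (d : ℝ≥0∞) < s + dimH B :=
    (ENNReal.sub_lt_iff_lt_right (ne_top_of_le_ne_top (ENNReal.natCast_ne_top d) hBd) hBd).1 hs
  have hs0 : 0 < s := by
    rw [pos_iff_ne_zero]
    rintro rfl
    rw [ENNReal.coe_zero, zero_add] at h2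
    exact absurd hBd h2.not_ge
  have h3 : (d : ℝ≥0∞) - s < dimH B := by
    rw [add_comm] at h2
    exact (ENNReal.sub_lt_iff_lt_right ENNReal.coe_ne_top hsd').2 h2
  obtain ⟨t, ht1, ht2⟩ := ENNReal.lt_iff_exists_nnreal_btwn.1 h3
  have hst : (d : ℝ≥0∞) < t + s := (ENNReal.sub_lt_iff_lt_right ENNReal.coe_ne_top hsd').1 ht1
  have ht0 : 0 < t := by exact_mod_cast zero_le.trans_lt ht1
  have hst' : (d : ℝ) < s + t := by
    rw [add_comm]
    exact_mod_cast hst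
  have := hμ.finite
  have hμA : ∀ᵐ a ∂μ, a ∈ A := by
    filter_upwards [Measure.support_mem_ae (μ := μ)] with a ha using hμ.support_subset ha
  have hH := hausdorffMeasure_eq_zero_of_volume_add_eq_zero hμ.ne_zero hμA (hA.add hB) hnull
    (s := s) (t := t) (by exact_mod_cast hs0) (by exact_mod_cast ht0) hst' hC
  have hle : dimH B ≤ t :=
    dimH_le_of_hausdorffMeasure_ne_top (by rw [hH]; exact ENNReal.zero_ne_top)
  exact absurd hle ht2.not_ge

end Sumset

theorem mainTheorem2 (d : ℕ) (R : Set ℝ) (Y Z : Set (EuclideanSpace ℝ (Fin d)))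
    (hRpos : R ⊆ Set.Ioi 0)
    (hR : IsCompact R) (hY : IsCompact Y) (hZ : IsCompact Z)
    (hRne : R.Nonempty) (hYne : Y.Nonempty) (hZne : Z.Nonempty)
    (hdim : (d : ℝ≥0∞) < max (fourierDim (R • Y) + dimH Z) (dimH (R • Y) + fourierDim Z)) :
    0 < volume (R • Y + Z) := by
  have hRY : IsCompact (R • Y) := hR.smul_set hY
  rcases lt_max_iff.1 hdim with h | h
  · exact volume_add_pos_of_lt_fourierDim_add_dimH hRY hZ h
  · rw [add_comm]
    exact volume_add_pos_of_lt_fourierDim_add_dimH hZ hRY (by rwa [add_comm])
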